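/- Let $n\ge 1$, let $L^2(\mathbb{R}^n)=L^2(\mathbb{R}^n;\mathbb{C})$ with norm $\|\cdot\|$ and scalar product $(u|v)=\int_{\mathbb{R}^n}u\,\overline{v}\,dx$, and let $H^1(\mathbb{R}^n)=\{\varphi\in L^2(\mathbb{R}^n);\ \partial_j\varphi\in L^2(\mathbb{R}^n)\text{ for } 1\le j\le n\}$, where the derivatives are distributional. Put $x\cdot\nabla\varphi=\sum_{j=1}^n x_j\,\partial_j\varphi$. (i) For all $\varphi\in H^1(\mathbb{R}^n)$ with $x\cdot\nabla\varphi\in L^2(\mathbb{R}^n)$, the orthogonality relation $$\mathrm{Re}\Bigl(x\cdot\nabla\varphi+\frac n2\varphi\Big|\varphi\Bigr)=0$$ and the equality $$\|x\cdot\nabla\varphi\|^2=\Bigl\|x\cdot\nabla\varphi+\frac n2\varphi\Bigr\|^2+\Bigl(\frac n2\Bigr)^2\|\varphi\|^2$$ hold. (ii) There is no $\varphi\in H^1(\mathbb{R}^n)\setminus\{0\}$ with $x\cdot\nabla\varphi\in L^2(\mathbb{R}^n)$ satisfying $$\|x\cdot\nabla\varphi\|^2=\Bigl(\frac n2\Bigr)^2\|\varphi\|^2.$$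 -/

import Mathlib

open MeasureTheory

open scoped ContDiff ENNReal

noncomputable section

/-- Complex `L²(ℝⁿ)` with Lebesgue measure. -/
abbrev L2 (n : ℕ) : Type :=
  Lp ℂ 2 (volume : Measure (EuclideanSpace ℝ (Fin n)))

/-- `g ∈ L²(ℝⁿ)` is the distributional partial derivative `∂ⱼφ` of `φ ∈ L²(ℝⁿ)`:
`∫ (∂ⱼη) φ dx = -∫ η g dx` for all test functions `η`. Real-valued test functions suffice,
since both sides are additive in `η` and a complex test function is `η₁ + iη₂`. -/
def IsWeakPartial {n : ℕ} (j : Fin n) (φ g : L2 n) : Prop :=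
  ∀ η : EuclideanSpace ℝ (Fin n) → ℝ, ContDiff ℝ ∞ η → HasCompactSupport η →
    ∫ x, (fderiv ℝ η x (EuclideanSpace.single j 1)) • φ x = -∫ x, η x • g x

/-- Distributional derivatives in `L²` are unique. -/
theorem IsWeakPartial.unique {n : ℕ} {j : Fin n} {φ g g' : L2 n}
    (h : IsWeakPartial j φ g) (h' : IsWeakPartial j φ g') : g = g' := by
  have hloc : ∀ f : L2 n, LocallyIntegrable f volume := fun f =>
    (Lp.memLp f).locallyIntegrable (by norm_num)
  refine Lp.ext (ae_eq_of_integral_contDiff_smul_eq (hloc g) (hloc g') ?_)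
  intro η h1 h2
  exact neg_injective ((h η h1 h2).symm.trans (h' η h1 h2))

/-- The Sobolev space `H¹(ℝⁿ) = {φ ∈ L² ; ∂ⱼφ ∈ L² for all j}`. -/
def H1 (n : ℕ) : Set (L2 n) :=
  {φ | ∀ j : Fin n, ∃ g : L2 n, IsWeakPartial j φ g}

open Classical in
/-- The distributional derivative `∂ⱼφ` (with value `0` if it is not in `L²`). -/
def weakPartial {n : ℕ} (j : Fin n) (φ : L2 n) : L2 n :=
  if h : ∃ g : L2 n, IsWeakPartial j φ g then h.choose else 0

/-- On `H¹` the function `weakPartial j φ` is the distributional derivative `∂ⱼφ`. -/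
theorem isWeakPartial_weakPartial {n : ℕ} {φ : L2 n} (hφ : φ ∈ H1 n) (j : Fin n) :
    IsWeakPartial j φ (weakPartial j φ) := by
  rw [weakPartial, dif_pos (hφ j)]
  exact (hφ j).choose_spec

/-- The function `x ↦ x · ∇φ(x) = ∑ⱼ xⱼ ∂ⱼφ(x)`, defined up to null sets for `φ ∈ H¹(ℝⁿ)`. -/
def xDotGrad {n : ℕ} (φ : L2 n) (x : EuclideanSpace ℝ (Fin n)) : ℂ :=
  ∑ j : Fin n, (x j : ℂ) * weakPartial j φ x

end

/-!
The operator `A = x · ∇ + n/2` is the generator of the unitary group of dilations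
`U_t f = e^{nt/2} f(eᵗ ·)` on `L²(ℝⁿ)`, and both parts of the theorem are read off this group.

Write `ψ = x · ∇φ + (n/2) φ`. Testing `∂ⱼφ` against `xⱼ η` and summing over `j` gives the weak form
`∫ (n/2 η + x · ∇η) φ = -∫ η ψ` (`integral_euler_smul`). After moving the dilation onto the test
function, differentiation under the integral sign yields `d/dt ⟨η, U_t φ⟩ = ⟨η, U_t ψ⟩` for all test
functions `η` (`hasDerivAt_inner_dilation`). These span a dense subspace, so
`‖U_t φ - φ‖ ≤ |t| ‖ψ‖` (`norm_sub_le_of_dense_weakDeriv`). Since `U_t` is isometric,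
`2 Re ⟨φ, U_t φ - φ⟩ = -‖U_t φ - φ‖² = O(t²)`, and passing to the derivative at `t = 0` gives
`Re ⟨φ, ψ⟩ = 0` (`re_inner_eq_zero_of_weakDeriv`). The norm identity is then Pythagoras' theorem
for `x · ∇φ = ψ - (n/2) φ`. No cutoff or mollification of `φ` is needed.

If equality holds in the resulting inequality, then `ψ = 0`, hence `U_t φ = φ` for all `t`, and the
mass `∫_{|x| ≤ R} |φ|²` does not depend on `R > 0`. It tends to `‖φ‖²` as `R → ∞` and to `0` as
`R → 0`, because points are null sets for `n ≥ 1`; so `φ = 0` (`eq_zero_of_dilation_eq_self`).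
-/

open Filter Topology

/-! ### Weakly differentiable curves of constant norm -/

/-- A curve whose derivative, tested against a dense set only, is `v` with `‖v‖ ≤ C`, is
`C`-Lipschitz at `0`: the mean value inequality holds for each test vector, and then by density
for the vector `u t - u 0` itself. -/
theorem norm_sub_le_of_dense_weakDeriv {H : Type*} [NormedAddCommGroup H]
    [InnerProductSpace ℂ H] {S : Set H} (hS : Dense S) {u v : ℝ → H} {C : ℝ}
    (hv : ∀ t, ‖v t‖ ≤ C)
    (huv : ∀ η ∈ S, ∀ t, HasDerivAt (fun s => inner ℂ η (u s)) (inner ℂ η (v t)) t) (t : ℝ) :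
    ‖u t - u 0‖ ≤ C * |t| := by
  have hC : 0 ≤ C := (norm_nonneg _).trans (hv 0)
  have key : ∀ η : H, ‖inner ℂ η (u t - u 0)‖ ≤ ‖η‖ * (C * |t|) := by
    intro η
    refine hS.induction (P := fun η => ‖inner ℂ η (u t - u 0)‖ ≤ ‖η‖ * (C * |t|)) ?_ ?_ η
    · intro η hη
      have := Convex.norm_image_sub_le_of_norm_hasDerivWithin_le (s := Set.univ)
        (C := ‖η‖ * C) (x := 0) (y := t)
        (fun s _ => (huv η hη s).hasDerivWithinAt)
        (fun s _ => (norm_inner_le_norm η (v s)).trans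
          (mul_le_mul_of_nonneg_left (hv s) (norm_nonneg _))) convex_univ trivial trivial
      simpa [inner_sub_right, mul_assoc] using this
    · exact isClosed_le (by fun_prop) (by fun_prop)
  have h := key (u t - u 0)
  rw [inner_self_eq_norm_sq_to_K] at h
  rcases (norm_nonneg (u t - u 0)).eq_or_lt with h0 | h0
  · rw [← h0]; positivity
  · refine le_of_mul_le_mul_left ?_ h0
    simpa [pow_two] using h

/-- A curve of constant norm is orthogonal (for the real inner product) to its velocity, even when
the velocity is only known weakly on a dense set. The vector `u 0` need not belong to that set, so
`|Re ⟨η, v 0⟩| ≤ ‖η - u 0‖ ‖v 0‖` is shown for `η` in it and extended by density to `η = u 0`. -/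
theorem re_inner_eq_zero_of_weakDeriv {H : Type*} [NormedAddCommGroup H]
    [InnerProductSpace ℂ H] {S : Set H} (hS : Dense S) {u v : ℝ → H}
    (hu : ∀ t, ‖u t‖ = ‖u 0‖) (hv : ∀ t, ‖v t‖ ≤ ‖v 0‖)
    (huv : ∀ η ∈ S, ∀ t, HasDerivAt (fun s => inner ℂ η (u s)) (inner ℂ η (v t)) t) :
    (inner ℂ (u 0) (v 0)).re = 0 := by
  have hlip := norm_sub_le_of_dense_weakDeriv hS hv huv
  have key : ∀ η : H, |(inner ℂ η (v 0)).re| ≤ ‖η - u 0‖ * ‖v 0‖ := by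
    intro η
    refine hS.induction (P := fun η => |(inner ℂ η (v 0)).re| ≤ ‖η - u 0‖ * ‖v 0‖) ?_ ?_ η
    · intro η hη
      have h1 : HasDerivAt (fun s => (inner ℂ η (u s)).re) (inner ℂ η (v 0)).re 0 :=
        Complex.reCLM.hasFDerivAt.comp_hasDerivAt _ (huv η hη 0)
      have h2 := (hasDerivAt_iff_tendsto_slope_zero.1 h1).abs
      have h3 : Tendsto (fun t : ℝ => ‖η - u 0‖ * ‖v 0‖ + ‖v 0‖ ^ 2 * |t| / 2) (𝓝[≠] 0)
          (𝓝 (‖η - u 0‖ * ‖v 0‖ + ‖v 0‖ ^ 2 * |0| / 2)) :=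
        (Continuous.tendsto (by fun_prop) 0).mono_left nhdsWithin_le_nhds
      simp only [abs_zero, mul_zero, zero_div, add_zero] at h3
      refine le_of_tendsto_of_tendsto h2 h3 ?_
      filter_upwards [self_mem_nhdsWithin] with t ht
      have ht' : 0 < |t| := abs_pos.2 ht
      have e1 : (inner ℂ η (u t)).re - (inner ℂ η (u 0)).re
          = (inner ℂ (η - u 0) (u t - u 0)).re + (inner ℂ (u 0) (u t - u 0)).re := by
        simp only [inner_sub_left, Complex.sub_re, inner_sub_right]
        ring
      -- Constancy of the norm makes the second summand quadratic in `t`.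
      have e2 : 2 * (inner ℂ (u 0) (u t - u 0)).re = - ‖u t - u 0‖ ^ 2 := by
        have := norm_add_sq (𝕜 := ℂ) (u 0) (u t - u 0)
        rw [add_sub_cancel, hu t] at this
        simp only [RCLike.re_to_complex] at this
        linarith
      have e3 : |(inner ℂ (η - u 0) (u t - u 0)).re| ≤ ‖η - u 0‖ * (‖v 0‖ * |t|) :=
        (Complex.abs_re_le_norm _).trans ((norm_inner_le_norm _ _).trans
          (mul_le_mul_of_nonneg_left (hlip t) (norm_nonneg _)))
      have e4 : ‖u t - u 0‖ ^ 2 ≤ (‖v 0‖ * |t|) ^ 2 :=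
        pow_le_pow_left₀ (norm_nonneg _) (hlip t) 2
      rw [zero_add, smul_eq_mul, abs_mul, abs_inv, e1, inv_mul_le_iff₀ ht']
      have e5 := abs_add_le (inner ℂ (η - u 0) (u t - u 0)).re (inner ℂ (u 0) (u t - u 0)).re
      have e6 : |(inner ℂ (u 0) (u t - u 0)).re| = ‖u t - u 0‖ ^ 2 / 2 := by
        rw [show (inner ℂ (u 0) (u t - u 0)).re = -(‖u t - u 0‖ ^ 2 / 2) by linarith,
          abs_neg, abs_of_nonneg (by positivity)]
      nlinarith
    · exact isClosed_le (by fun_prop) (by fun_prop)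
  simpa using key (u 0)

/-! ### Density of real test functions -/

/-- A complex subspace of `L²(ℝⁿ)` containing the real-valued test functions is dense. -/
theorem dense_of_testFunction_mem {n : ℕ} (K : Submodule ℂ (L2 n))
    (hK : ∀ η : EuclideanSpace ℝ (Fin n) → ℝ, ContDiff ℝ ∞ η → HasCompactSupport η →
      ∀ hm : MemLp (fun x => (η x : ℂ)) 2 volume, hm.toLp _ ∈ K) :
    Dense (K : Set (L2 n)) := by
  rw [Submodule.dense_iff_topologicalClosure_eq_top, Submodule.topologicalClosure_eq_top_iff,
    Submodule.eq_bot_iff]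
  intro f hf
  rw [Lp.eq_zero_iff_ae_eq_zero]
  refine ae_eq_zero_of_integral_contDiff_smul_eq_zero
    ((Lp.memLp f).locallyIntegrable (by norm_num)) fun η h1 h2 => ?_
  have hm : MemLp (fun x => (η x : ℂ)) 2 (volume : Measure (EuclideanSpace ℝ (Fin n))) :=
    (Complex.continuous_ofReal.comp h1.continuous).memLp_of_hasCompactSupport
      (h2.comp_left Complex.ofReal_zero)
  have h0 := hf _ (hK η h1 h2 hm)
  rw [L2.inner_def] at h0
  rw [← h0]
  refine integral_congr_ae ?_
  filter_upwards [hm.coeFn_toLp] with x hx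
  simp [hx, RCLike.inner_apply, mul_comm]

/-! ### The dilation group -/

theorem memLp_dilation {n : ℕ} (t : ℝ) (f : L2 n) :
    MemLp (fun x => Real.exp (n * t / 2) • f (Real.exp t • x)) 2 volume := by
  have ht : Real.exp t ≠ 0 := (Real.exp_pos t).ne'
  suffices h : MemLp (fun x => f (Real.exp t • x)) 2 volume from h.const_smul (Real.exp (n * t / 2))
  refine MemLp.comp_of_map (f := fun x => Real.exp t • x) (g := f) ?_ (by fun_prop)
  rw [Measure.map_addHaar_smul _ ht]
  exact (Lp.memLp f).smul_measure ENNReal.ofReal_ne_top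

/-- The unitary dilation `f ↦ e^{nt/2} f(eᵗ ·)` of `L²(ℝⁿ)`; its generator is `x · ∇ + n/2`. -/
noncomputable def dilation {n : ℕ} (t : ℝ) (f : L2 n) : L2 n := (memLp_dilation t f).toLp _

theorem coeFn_dilation {n : ℕ} (t : ℝ) (f : L2 n) :
    dilation t f =ᵐ[volume] fun x => Real.exp (n * t / 2) • f (Real.exp t • x) :=
  (memLp_dilation t f).coeFn_toLp

theorem dilation_zero {n : ℕ} (f : L2 n) : dilation 0 f = f := by
  refine Lp.ext ((coeFn_dilation 0 f).trans (Eventually.of_forall fun x => ?_))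
  simp

theorem norm_sq_dilation {n : ℕ} (t : ℝ) (f : L2 n) :
    (fun x => ‖dilation t f x‖ ^ 2)
      =ᵐ[volume] fun x => Real.exp (n * t) * ‖f (Real.exp t • x)‖ ^ 2 := by
  filter_upwards [coeFn_dilation t f] with x hx
  rw [hx, norm_smul, Real.norm_of_nonneg (Real.exp_pos _).le, mul_pow, ← Real.exp_nat_mul]
  congr 2
  push_cast; ring

theorem L2.norm_sq_eq_integral {n : ℕ} (f : L2 n) : ‖f‖ ^ 2 = ∫ x, ‖f x‖ ^ 2 := by
  have h : inner ℂ f f = ((∫ x, ‖f x‖ ^ 2 : ℝ) : ℂ) := by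
    rw [L2.inner_def, ← integral_complex_ofReal]
    refine integral_congr_ae (Eventually.of_forall fun x => ?_)
    simp
  rw [inner_self_eq_norm_sq_to_K] at h
  exact Complex.ofReal_injective ((Complex.ofReal_pow _ _).trans h)

theorem setIntegral_closedBall_norm_sq_dilation {n : ℕ} (t : ℝ) (f : L2 n) {R : ℝ} (hR : 0 ≤ R) :
    ∫ x in Metric.closedBall 0 R, ‖dilation t f x‖ ^ 2
      = ∫ x in Metric.closedBall 0 (Real.exp t * R), ‖f x‖ ^ 2 := by
  have h1 : ∫ x in Metric.closedBall 0 R, ‖dilation t f x‖ ^ 2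
      = ∫ x in Metric.closedBall 0 R, Real.exp (n * t) * ‖f (Real.exp t • x)‖ ^ 2 := by
    exact integral_congr_ae (ae_restrict_of_ae (norm_sq_dilation t f))
  rw [h1, integral_const_mul,
    Measure.setIntegral_comp_smul_of_pos volume (fun x => ‖f x‖ ^ 2) _ (Real.exp_pos t),
    finrank_euclideanSpace_fin, ← Real.exp_nat_mul, smul_eq_mul,
    mul_inv_cancel_left₀ (Real.exp_pos _).ne', smul_closedBall _ _ hR, smul_zero,
    Real.norm_of_nonneg (Real.exp_pos _).le]

theorem norm_dilation {n : ℕ} (t : ℝ) (f : L2 n) : ‖dilation t f‖ = ‖f‖ := by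
  rw [← sq_eq_sq₀ (norm_nonneg _) (norm_nonneg _), L2.norm_sq_eq_integral, L2.norm_sq_eq_integral]
  rw [integral_congr_ae (norm_sq_dilation t f), integral_const_mul,
    Measure.integral_comp_smul volume (fun x => ‖f x‖ ^ 2),
    finrank_euclideanSpace_fin, ← Real.exp_nat_mul, smul_eq_mul,
    abs_of_pos (inv_pos.2 (Real.exp_pos _)), mul_inv_cancel_left₀ (Real.exp_pos _).ne']

/-- A dilation-invariant `f` has the same mass in all balls centred at `0`; letting the radius tend
to `0` and to `∞` shows that this mass is both `0` and `‖f‖²`. -/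
theorem eq_zero_of_dilation_eq_self {n : ℕ} (hn : 1 ≤ n) {f : L2 n}
    (hf : ∀ t, dilation t f = f) : f = 0 := by
  have hint : Integrable (fun x => ‖f x‖ ^ 2) volume :=
    (Lp.memLp f).integrable_norm_pow (by norm_num)
  set m : ℝ → ℝ := fun R => ∫ x in Metric.closedBall 0 R, ‖f x‖ ^ 2 with hm
  have hm1 : ∀ R, 0 < R → m R = m 1 := by
    intro R hR
    have := setIntegral_closedBall_norm_sq_dilation (Real.log R) f zero_le_one
    rw [hf, Real.exp_log hR, mul_one] at this
    exact this.symm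
  have hpos : ∀ k : ℕ, (0 : ℝ) < k + 1 := fun k => by positivity
  have hbig := tendsto_setIntegral_of_monotone (μ := volume) (f := fun x => ‖f x‖ ^ 2)
    (s := fun k : ℕ => Metric.closedBall (0 : EuclideanSpace ℝ (Fin n)) (k + 1))
    (fun k => measurableSet_closedBall)
    (fun a b h => Metric.closedBall_subset_closedBall (by gcongr)) hint.integrableOn
  have hsmall := tendsto_setIntegral_of_antitone (μ := volume) (f := fun x => ‖f x‖ ^ 2)
    (s := fun k : ℕ => Metric.closedBall (0 : EuclideanSpace ℝ (Fin n)) (1 / (k + 1)))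
    (fun k => measurableSet_closedBall)
    (fun a b h => Metric.closedBall_subset_closedBall
      (one_div_le_one_div_of_le (by positivity) (by gcongr)))
    ⟨0, hint.integrableOn⟩
  have hU : ⋃ k : ℕ, Metric.closedBall (0 : EuclideanSpace ℝ (Fin n)) (k + 1) = Set.univ := by
    refine Set.eq_univ_of_forall fun x => ?_
    obtain ⟨k, hk⟩ := exists_nat_ge ‖x‖
    exact Set.mem_iUnion.2 ⟨k, by rw [mem_closedBall_zero_iff]; linarith⟩
  have hI : ⋂ k : ℕ, Metric.closedBall (0 : EuclideanSpace ℝ (Fin n)) (1 / (k + 1)) = {0} := by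
    refine Set.Subset.antisymm (fun x hx => ?_) (fun x hx => ?_)
    · have h : ‖x‖ ≤ 0 := ge_of_tendsto' tendsto_one_div_add_atTop_nhds_zero_nat
        fun k => mem_closedBall_zero_iff.1 (Set.mem_iInter.1 hx k)
      exact norm_le_zero_iff.1 h
    · rw [Set.mem_singleton_iff.1 hx]
      exact Set.mem_iInter.2 fun k => Metric.mem_closedBall_self (by positivity)
  have : Nonempty (Fin n) := ⟨⟨0, hn⟩⟩
  rw [hU, setIntegral_univ, ← L2.norm_sq_eq_integral] at hbig
  rw [hI, setIntegral_measure_zero _ (measure_singleton _)] at hsmall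
  have e1 : ‖f‖ ^ 2 = m 1 := tendsto_nhds_unique hbig
    (tendsto_const_nhds.congr fun k => (hm1 _ (hpos k)).symm)
  have e2 : (0 : ℝ) = m 1 := tendsto_nhds_unique hsmall
    (tendsto_const_nhds.congr fun k => (hm1 _ (one_div_pos.2 (hpos k))).symm)
  rw [← e2] at e1
  exact norm_eq_zero.1 (pow_eq_zero_iff two_ne_zero |>.1 e1)

/-! ### The weak form of the generator -/

theorem integrable_testFunction_smul {n : ℕ} {η : EuclideanSpace ℝ (Fin n) → ℝ}
    (h1 : Continuous η) (h2 : HasCompactSupport η) (f : L2 n) :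
    Integrable (fun x => η x • f x) volume :=
  ((Lp.memLp f).locallyIntegrable (by norm_num)).integrable_smul_left_of_hasCompactSupport h1 h2

theorem fderiv_apply_eq_sum {n : ℕ} (η : EuclideanSpace ℝ (Fin n) → ℝ)
    (x : EuclideanSpace ℝ (Fin n)) :
    fderiv ℝ η x x = ∑ j, x j * fderiv ℝ η x (EuclideanSpace.single j 1) := by
  have hx : x = ∑ j, x j • EuclideanSpace.single j (1 : ℝ) := by
    ext i
    simp [Finset.sum_apply, Pi.single_apply]
  conv_lhs => rw [congrArg (fderiv ℝ η x) hx]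
  simp only [map_sum, map_smul, smul_eq_mul]

/-- Weak form of the formal skew-adjointness of `x · ∇ + n/2`: on the left it acts on the test
function `η`, on the right on `φ`. -/
theorem integral_euler_smul {n : ℕ} {φ : L2 n} (hφ : φ ∈ H1 n)
    (hx : MemLp (xDotGrad φ) 2 volume) {η : EuclideanSpace ℝ (Fin n) → ℝ}
    (h1 : ContDiff ℝ ∞ η) (h2 : HasCompactSupport η) :
    ∫ x, (n / 2 * η x + fderiv ℝ η x x) • φ x
      = -∫ x, η x • (hx.toLp (xDotGrad φ) + ((n : ℂ) / 2) • φ) x := by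
  have hd : ∀ v, Continuous fun x => fderiv ℝ η x v := fun v =>
    (h1.continuous_fderiv (by simp)).clm_apply continuous_const
  have hds : ∀ v, HasCompactSupport fun x => fderiv ℝ η x v := fun v =>
    (h2.fderiv (𝕜 := ℝ)).comp_left (g := fun L : EuclideanSpace ℝ (Fin n) →L[ℝ] ℝ => L v) rfl
  have hc : ∀ j : Fin n, Continuous fun x : EuclideanSpace ℝ (Fin n) => x j := fun j => by fun_prop
  have hφη := integrable_testFunction_smul h1.continuous h2 φ
  have hφd : ∀ j : Fin n, Integrable
      (fun x => (x j * fderiv ℝ η x (EuclideanSpace.single j 1)) • φ x) volume := fun j =>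
    integrable_testFunction_smul ((hc j).mul (hd _)) (hds _).mul_left φ
  have hgj : ∀ j : Fin n, Integrable (fun x => (x j * η x) • weakPartial j φ x) volume := fun j =>
    integrable_testFunction_smul ((hc j).mul h1.continuous) h2.mul_left _
  -- The distributional derivative tested against `xⱼ η`.
  have key : ∀ j : Fin n,
      (∫ x, η x • φ x) + ∫ x, (x j * fderiv ℝ η x (EuclideanSpace.single j 1)) • φ x
        = -∫ x, (x j * η x) • weakPartial j φ x := by
    intro j
    have hcd : ContDiff ℝ ∞ fun x : EuclideanSpace ℝ (Fin n) => x j * η x :=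
      ContDiff.mul (by fun_prop) h1
    rw [← isWeakPartial_weakPartial hφ j _ hcd h2.mul_left, ← integral_add hφη (hφd j)]
    refine integral_congr_ae (Eventually.of_forall fun x => ?_)
    have hp : HasFDerivAt (fun y : EuclideanSpace ℝ (Fin n) => y j)
        (EuclideanSpace.proj j : EuclideanSpace ℝ (Fin n) →L[ℝ] ℝ) x :=
      (EuclideanSpace.proj j : EuclideanSpace ℝ (Fin n) →L[ℝ] ℝ).hasFDerivAt
    have hfd : fderiv ℝ (fun y : EuclideanSpace ℝ (Fin n) => y j * η y) x = _ :=
      (hp.mul ((h1.differentiable (by simp)) x).hasFDerivAt).fderiv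
    simp only [hfd]
    simp
    ring
  have hsum := Finset.sum_congr (rfl : (Finset.univ : Finset (Fin n)) = Finset.univ)
    fun j _ => key j
  rw [Finset.sum_add_distrib, Finset.sum_const, Finset.card_univ, Fintype.card_fin,
    Finset.sum_neg_distrib, ← integral_finsetSum _ fun j _ => hφd j,
    ← integral_finsetSum _ fun j _ => hgj j] at hsum
  have hF : ∫ x, η x • (hx.toLp (xDotGrad φ) + ((n : ℂ) / 2) • φ) x
      = (∫ x, ∑ j : Fin n, (x j * η x) • weakPartial j φ x)
        + ∫ x, ((n : ℂ) / 2) * (η x • φ x) := by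
    rw [← integral_add (integrable_finsetSum _ fun j _ => hgj j) (hφη.const_mul _)]
    refine integral_congr_ae ?_
    filter_upwards [Lp.coeFn_add (hx.toLp (xDotGrad φ)) (((n : ℂ) / 2) • φ),
      Lp.coeFn_smul ((n : ℂ) / 2) φ, hx.coeFn_toLp] with x e1 e2 e3
    simp only [e1, Pi.add_apply, e2, e3, Pi.smul_apply, xDotGrad, smul_add, Finset.smul_sum,
      Complex.real_smul, smul_eq_mul]
    congr 1
    · refine Finset.sum_congr rfl fun j _ => ?_
      push_cast; ring
    · ring
  have hL : ∫ x, (n / 2 * η x + fderiv ℝ η x x) • φ x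
      = (∫ x, ((n : ℂ) / 2) * (η x • φ x))
        + ∫ x, ∑ j : Fin n, (x j * fderiv ℝ η x (EuclideanSpace.single j 1)) • φ x := by
    rw [← integral_add (hφη.const_mul _) (integrable_finsetSum _ fun j _ => hφd j)]
    refine integral_congr_ae (Eventually.of_forall fun x => ?_)
    simp only [fderiv_apply_eq_sum η x, add_smul, Finset.sum_smul]
    congr 1
    simp only [Complex.real_smul]
    push_cast; ring
  rw [hF, hL, integral_const_mul]
  rw [nsmul_eq_mul] at hsum
  linear_combination hsum

/-! ### Differentiating along the dilation group -/

/-- Change of variables: the adjoint of the dilation by `t` is the dilation by `-t`. -/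
theorem inner_dilation_eq_integral {n : ℕ} {η : EuclideanSpace ℝ (Fin n) → ℝ}
    (hm : MemLp (fun x => (η x : ℂ)) 2 volume) (f : L2 n) (t : ℝ) :
    inner ℂ (hm.toLp _) (dilation t f)
      = ∫ x, (Real.exp (-(n * t / 2)) * η (Real.exp (-t) • x)) • f x := by
  have h1 : inner ℂ (hm.toLp _) (dilation t f)
      = ∫ x, (fun y => (Real.exp (n * t / 2) * η (Real.exp (-t) • y)) • f y) (Real.exp t • x) := by
    rw [L2.inner_def]
    refine integral_congr_ae ?_
    filter_upwards [hm.coeFn_toLp, coeFn_dilation t f] with x e1 e2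
    simp only [e1, e2, smul_smul, ← Real.exp_add]
    simp [RCLike.inner_apply]
    ring
  rw [h1, Measure.integral_comp_smul volume
    (fun y => (Real.exp (n * t / 2) * η (Real.exp (-t) • y)) • f y),
    finrank_euclideanSpace_fin, ← Real.exp_nat_mul, ← integral_smul,
    abs_of_pos (inv_pos.2 (Real.exp_pos _))]
  refine integral_congr_ae (Eventually.of_forall fun x => ?_)
  simp only [smul_smul, ← Real.exp_neg, ← mul_assoc, ← Real.exp_add]
  congr 4
  ring

/-- Along the group the test function moves by minus the generator: with `ζ = (n/2) η + x · ∇η`, the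
derivative of `e^{-nt/2} η(e⁻ᵗ x)` in `t` is `-e^{-nt/2} ζ(e⁻ᵗ x)`. -/
theorem hasDerivAt_integral_dilation {n : ℕ} {η : EuclideanSpace ℝ (Fin n) → ℝ}
    (h1 : ContDiff ℝ ∞ η) (h2 : HasCompactSupport η) (f : L2 n) (t : ℝ) :
    HasDerivAt (fun s => ∫ x, (Real.exp (-(n * s / 2)) * η (Real.exp (-s) • x)) • f x)
      (∫ x, (-(Real.exp (-(n * t / 2)) * (n / 2 * η (Real.exp (-t) • x)
        + fderiv ℝ η (Real.exp (-t) • x) (Real.exp (-t) • x)))) • f x) t := by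
  set ζ : EuclideanSpace ℝ (Fin n) → ℝ := fun y => n / 2 * η y + fderiv ℝ η y y with hζ
  have hη : Continuous η := h1.continuous
  have hζc : Continuous ζ :=
    (hη.const_mul _).add ((h1.continuous_fderiv (by simp)).clm_apply continuous_id)
  have hζs : HasCompactSupport ζ := by
    refine HasCompactSupport.add h2.mul_left ?_
    refine (h2.fderiv (𝕜 := ℝ)).mono fun y hy => ?_
    contrapose! hy
    simp only [Function.mem_support, not_not] at hy ⊢
    simp [hy]
  obtain ⟨M, hM⟩ := hζs.exists_bound_of_continuous hζc
  obtain ⟨R, hR⟩ := hζs.isCompact.isBounded.subset_closedBall (0 : EuclideanSpace ℝ (Fin n))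
  have hM0 : 0 ≤ M := (norm_nonneg _).trans (hM 0)
  have hint : ∀ s : ℝ, ∀ θ : EuclideanSpace ℝ (Fin n) → ℝ, Continuous θ → HasCompactSupport θ →
      Integrable (fun x => (Real.exp (-(n * s / 2)) * θ (Real.exp (-s) • x)) • f x) volume :=
    fun s θ hc hs => integrable_testFunction_smul (by fun_prop)
      (hs.comp_smul (Real.exp_pos (-s)).ne').mul_left f
  -- For `|s - t| < 1` the integrand's derivative is supported in this ball.
  set B : Set (EuclideanSpace ℝ (Fin n)) := Metric.closedBall 0 (Real.exp (t + 1) * R) with hB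
  refine (hasDerivAt_integral_of_dominated_loc_of_deriv_le (μ := volume)
    (F := fun s x => (Real.exp (-(n * s / 2)) * η (Real.exp (-s) • x)) • f x)
    (F' := fun s x => (-(Real.exp (-(n * s / 2)) * ζ (Real.exp (-s) • x))) • f x)
    (s := Metric.ball t 1)
    (bound := B.indicator fun x => Real.exp (n * (1 - t) / 2) * M * ‖f x‖)
    (Metric.ball_mem_nhds t one_pos) (Eventually.of_forall fun s => (hint s η hη h2).1)
    (hint t η hη h2) ?_ ?_ ?_ ?_).2
  · refine (hint t ζ hζc hζs).1.neg.congr (Eventually.of_forall fun x => ?_)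
    simp only [Pi.neg_apply, neg_smul]
  · refine Eventually.of_forall fun x s hs => ?_
    rw [Metric.mem_ball, Real.dist_eq, abs_lt] at hs
    by_cases hxB : x ∈ B
    · rw [Set.indicator_of_mem hxB, norm_smul, norm_neg, norm_mul,
        Real.norm_of_nonneg (Real.exp_pos _).le]
      refine mul_le_mul_of_nonneg_right (mul_le_mul (Real.exp_le_exp.2 ?_) (hM _)
        (norm_nonneg _) (Real.exp_pos _).le) (norm_nonneg _)
      have : (0 : ℝ) ≤ n := n.cast_nonneg
      nlinarith
    · have : ζ (Real.exp (-s) • x) = 0 := by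
        by_contra hne
        apply hxB
        have h := mem_closedBall_zero_iff.1 (hR (subset_tsupport _ hne))
        rw [norm_smul, Real.norm_of_nonneg (Real.exp_pos _).le, Real.exp_neg,
          inv_mul_le_iff₀ (Real.exp_pos _)] at h
        rw [hB, mem_closedBall_zero_iff]
        have hR0 : 0 ≤ R := by
          by_contra hneg
          exact absurd ((norm_nonneg x).trans h)
            (not_le.2 (mul_neg_of_pos_of_neg (Real.exp_pos _) (not_le.1 hneg)))
        exact h.trans (mul_le_mul_of_nonneg_right (Real.exp_le_exp.2 (by linarith)) hR0)
      simp [this, Set.indicator_of_notMem hxB]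
  · refine (IntegrableOn.integrable_indicator ?_ measurableSet_closedBall)
    exact (((Lp.memLp f).locallyIntegrable (by norm_num)).integrableOn_isCompact
      (isCompact_closedBall _ _)).norm.const_mul _
  · refine Eventually.of_forall fun x s _ => HasDerivAt.smul_const ?_ _
    have d1 : HasDerivAt (fun s : ℝ => Real.exp (-s) • x) (-(Real.exp (-s) • x)) s := by
      simpa using ((hasDerivAt_neg s).exp).smul_const x
    have d2 := ((h1.differentiable (by simp)) (Real.exp (-s) • x)).hasFDerivAt.comp_hasDerivAt s d1
    have d3 : HasDerivAt (fun s : ℝ => Real.exp (-(n * s / 2)))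
        (Real.exp (-(n * s / 2)) * (-(n / 2))) s := by
      refine HasDerivAt.exp ?_
      simpa using (((hasDerivAt_id s).const_mul (n : ℝ)).div_const 2).fun_neg
    refine (d3.mul d2).congr_deriv ?_
    simp only [hζ, map_neg, Function.comp]
    ring

theorem hasDerivAt_inner_dilation {n : ℕ} {φ : L2 n} (hφ : φ ∈ H1 n)
    (hx : MemLp (xDotGrad φ) 2 volume) {η : EuclideanSpace ℝ (Fin n) → ℝ}
    (h1 : ContDiff ℝ ∞ η) (h2 : HasCompactSupport η)
    (hm : MemLp (fun x => (η x : ℂ)) 2 volume) (t : ℝ) :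
    HasDerivAt (fun s => inner ℂ (hm.toLp _) (dilation s φ))
      (inner ℂ (hm.toLp _) (dilation t (hx.toLp (xDotGrad φ) + ((n : ℂ) / 2) • φ))) t := by
  simp only [inner_dilation_eq_integral]
  refine (hasDerivAt_integral_dilation h1 h2 φ t).congr_deriv ?_
  have hθ1 : ContDiff ℝ ∞ fun x => Real.exp (-(n * t / 2)) * η (Real.exp (-t) • x) :=
    contDiff_const.mul (h1.comp (contDiff_const_smul _))
  have hθ2 : HasCompactSupport fun x => Real.exp (-(n * t / 2)) * η (Real.exp (-t) • x) :=
    (h2.comp_smul (Real.exp_pos (-t)).ne').mul_left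
  rw [← neg_eq_iff_eq_neg.2 (integral_euler_smul hφ hx hθ1 hθ2), ← integral_neg]
  refine integral_congr_ae (Eventually.of_forall fun x => ?_)
  have hd : HasFDerivAt (fun y => Real.exp (-(n * t / 2)) * η (Real.exp (-t) • y))
      (Real.exp (-(n * t / 2)) • (fderiv ℝ η (Real.exp (-t) • x)).comp
        (Real.exp (-t) • ContinuousLinearMap.id ℝ (EuclideanSpace ℝ (Fin n)))) x :=
    (((h1.differentiable (by simp)) (Real.exp (-t) • x)).hasFDerivAt.comp x
      ((hasFDerivAt_id x).const_smul (Real.exp (-t)))).const_mul _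
  simp only [hd.fderiv, ← neg_smul]
  congr 2
  simp
  ring

/-- The vectors against which the curve `t ↦ U_t φ` has derivative `U_t ψ`, where
`ψ = x · ∇φ + (n/2) φ`, form a subspace, which is dense as it contains the test functions. -/
theorem exists_dense_hasDerivAt_inner_dilation {n : ℕ} {φ : L2 n} (hφ : φ ∈ H1 n)
    (hx : MemLp (xDotGrad φ) 2 volume) :
    ∃ S : Set (L2 n), Dense S ∧ ∀ η ∈ S, ∀ t,
      HasDerivAt (fun s => inner ℂ η (dilation s φ))
        (inner ℂ η (dilation t (hx.toLp (xDotGrad φ) + ((n : ℂ) / 2) • φ))) t := by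
  let K : Submodule ℂ (L2 n) :=
    { carrier := {η | ∀ t, HasDerivAt (fun s => inner ℂ η (dilation s φ))
        (inner ℂ η (dilation t (hx.toLp (xDotGrad φ) + ((n : ℂ) / 2) • φ))) t}
      add_mem' := fun ha hb t => by
        simp only [inner_add_left]
        exact (ha t).add (hb t)
      zero_mem' := fun t => by
        simp only [inner_zero_left]
        exact hasDerivAt_const t 0
      smul_mem' := fun c a ha t => by
        simp only [inner_smul_left]
        exact (ha t).const_mul _ }
  exact ⟨K, dense_of_testFunction_mem K fun η h1 h2 hm =>
    hasDerivAt_inner_dilation hφ hx h1 h2 hm, fun η hη => hη⟩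

theorem re_inner_euler_eq_zero {n : ℕ} {φ : L2 n} (hφ : φ ∈ H1 n)
    (hx : MemLp (xDotGrad φ) 2 volume) :
    (inner ℂ φ (hx.toLp (xDotGrad φ) + ((n : ℂ) / 2) • φ)).re = 0 := by
  obtain ⟨S, hS, hd⟩ := exists_dense_hasDerivAt_inner_dilation hφ hx
  simpa only [dilation_zero] using re_inner_eq_zero_of_weakDeriv hS
    (fun t => by simp only [norm_dilation]) (fun t => by simp only [norm_dilation, le_refl]) hd

theorem norm_sq_xDotGrad {n : ℕ} {φ : L2 n} (hφ : φ ∈ H1 n)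
    (hx : MemLp (xDotGrad φ) 2 volume) :
    ‖hx.toLp (xDotGrad φ)‖ ^ 2
        = ‖hx.toLp (xDotGrad φ) + ((n : ℂ) / 2) • φ‖ ^ 2 + ((n : ℝ) / 2) ^ 2 * ‖φ‖ ^ 2 := by
  have h0 := re_inner_euler_eq_zero hφ hx
  set ψ := hx.toLp (xDotGrad φ) + ((n : ℂ) / 2) • φ with hψ
  have h : hx.toLp (xDotGrad φ) = ψ - ((n : ℂ) / 2) • φ := by rw [hψ, add_sub_cancel_right]
  have hn : ((n : ℂ) / 2) = ((n / 2 : ℝ) : ℂ) := by push_cast; rfl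
  rw [h, norm_sub_sq (𝕜 := ℂ), inner_smul_right, ← inner_conj_symm, hn, RCLike.re_to_complex,
    Complex.re_ofReal_mul, Complex.conj_re, h0, norm_smul, Complex.norm_real,
    Real.norm_of_nonneg (by positivity)]
  ring

theorem eq_zero_of_euler_eq_zero {n : ℕ} (hn : 1 ≤ n) {φ : L2 n} (hφ : φ ∈ H1 n)
    (hx : MemLp (xDotGrad φ) 2 volume)
    (h : hx.toLp (xDotGrad φ) + ((n : ℂ) / 2) • φ = 0) : φ = 0 := by
  obtain ⟨S, hS, hd⟩ := exists_dense_hasDerivAt_inner_dilation hφ hx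
  refine eq_zero_of_dilation_eq_self hn fun t => ?_
  have := norm_sub_le_of_dense_weakDeriv hS (C := 0)
    (fun t => by rw [norm_dilation, h, norm_zero]) hd t
  rw [zero_mul, dilation_zero] at this
  exact sub_eq_zero.1 (norm_le_zero_iff.1 this)

theorem theorem3p2 (n : ℕ) (hn : 1 ≤ n) :
    (∀ φ ∈ H1 n, ∀ hx : MemLp (xDotGrad φ) 2 volume,
      (inner ℂ φ (hx.toLp (xDotGrad φ) + ((n : ℂ) / 2) • φ)).re = 0 ∧
      ‖hx.toLp (xDotGrad φ)‖ ^ 2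
        = ‖hx.toLp (xDotGrad φ) + ((n : ℂ) / 2) • φ‖ ^ 2 + ((n : ℝ) / 2) ^ 2 * ‖φ‖ ^ 2) ∧
    ¬ ∃ φ ∈ H1 n, φ ≠ 0 ∧ ∃ hx : MemLp (xDotGrad φ) 2 volume,
      ‖hx.toLp (xDotGrad φ)‖ ^ 2 = ((n : ℝ) / 2) ^ 2 * ‖φ‖ ^ 2 := by
  refine ⟨fun φ hφ hx => ⟨re_inner_euler_eq_zero hφ hx, norm_sq_xDotGrad hφ hx⟩, ?_⟩
  rintro ⟨φ, hφ, hne, hx, h⟩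
  refine hne (eq_zero_of_euler_eq_zero hn hφ hx ?_)
  rw [norm_sq_xDotGrad hφ hx] at h
  exact norm_eq_zero.1 (pow_eq_zero_iff two_ne_zero |>.1 (by linarith))
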